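/- Let $\Gamma<\mathrm{PSL}(2,\mathbb R)$ be an arithmetic Fuchsian group, that is, a discrete subgroup commensurable with $P\rho(\mathcal O^1)$, where $k$ is a totally real number field with a real embedding $\sigma$, $A$ is a quaternion algebra over $k$ that is split at $\sigma$ and ramified at every other real place, $\rho: A\to M_2(\mathbb R)$ is a ring homomorphism that restricts to $\sigma$ on $k$, $\mathcal O$ is an order of $A$, and $\mathcal O^1$ is its group of units of reduced norm $1$. Let $\Sigma=\mathbb H/\Gamma$. A closed geodesic of $\Sigma$ is the (unoriented) projection to $\Sigma$ of the axis of a hyperbolic element of $\Gamma$. If $\alpha,\beta$ are closed geodesics of $\Sigma$ (possibly $\alpha=\beta$) that meet transversely at $z\in\Sigma$, because lifts $\hat\alpha,\hat\beta\subset\mathbb H$ of them cross at a point above $z$, then $\alpha\angle_z\beta\in(0,\pi)$ denotes the angle measured counter-clockwise from $\hat\alpha$ to $\hat\beta$ at that point. The angle spectrum of $\Sigma$ is the collection of all these angles, and the multiplicity of a value $\theta$ in it is the number of triples $(\alpha,\beta,z)$ with $\alpha\angle_z\beta=\theta$. Then every value $\theta$ in the angle spectrum of $\Sigma$ has infinite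 multiplicity. -/

import Mathlib

open scoped MatrixGroups UpperHalfPlane

noncomputable section

namespace FuchsianAngles

/-! ### The action of `PSL(2, ℝ)` on the hyperbolic plane, axes of hyperbolic elements -/

/-- `PSL(2, ℝ)` acts on the upper half-plane by Moebius transformations. -/
instance pslAction : MulAction PSL(2, ℝ) ℍ :=
  MulAction.compHom ℍ (Matrix.ProjectiveSpecialLinearGroup.toPGL (n := Fin 2) (R := ℝ))

theorem mk_smul (A : SL(2, ℝ)) (z : ℍ) : ((A : PSL(2, ℝ)) • z : ℍ) = A • z := by
  change Matrix.ProjectiveSpecialLinearGroup.toPGL (A : PSL(2, ℝ)) • z = _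
  rw [Matrix.ProjectiveSpecialLinearGroup.toPGL_mk, UpperHalfPlane.pglMk_smul]
  rfl

/-- An element of `PSL(2, ℝ)` is hyperbolic if it is the class of a matrix of determinant one
with `trace ^ 2 > 4` (two distinct real eigenvalues). -/
def IsHyperbolic (g : PSL(2, ℝ)) : Prop :=
  ∃ A : SL(2, ℝ), (A : PSL(2, ℝ)) = g ∧ (A : Matrix (Fin 2) (Fin 2) ℝ).IsHyperbolic

/-- The axis of a hyperbolic isometry `g`: the set of points that `g` moves least with respect to
the hyperbolic distance. For hyperbolic `g` this is the complete geodesic that joins the two fixed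
points of `g` on the boundary, and `g` acts on it as a translation. -/
def axis (g : PSL(2, ℝ)) : Set ℍ :=
  {z | ∀ w : ℍ, dist z (g • z) ≤ dist w (g • w)}

/-- `v` is a unit tangent vector (for the hyperbolic metric) at `z` of the complete geodesic `L`:
the velocity at time `0` of an arc length parametrization of `L` that is at `z` at time `0`.
Tangent vectors of the half-plane are written as complex numbers. -/
def IsUnitTangent (L : Set ℍ) (z : ℍ) (v : ℂ) : Prop :=
  ∃ c : ℝ → ℍ, Isometry c ∧ Set.range c = L ∧ c 0 = z ∧ HasDerivAt (fun t : ℝ => (c t : ℂ)) v 0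

/-- The complete geodesics `L` and `M` cross at `z`, and `θ`, with `0 < θ < π`, is the angle at `z`
measured counter-clockwise from `L` to `M` (geodesics are not oriented). The hyperbolic metric is
conformal, so that angles are Euclidean angles between tangent vectors. -/
def IsAngle (L M : Set ℍ) (z : ℍ) (θ : ℝ) : Prop :=
  θ ∈ Set.Ioo 0 Real.pi ∧
    ∃ v w : ℂ, IsUnitTangent L z v ∧ IsUnitTangent M z w ∧
      w = Complex.exp (θ * Complex.I) * v

/-! ### The surface, its closed geodesics and its angle spectrum -/

/-- The quotient `Σ = ℍ / Γ`. -/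
abbrev Surface (Γ : Subgroup PSL(2, ℝ)) : Type := MulAction.orbitRel.Quotient Γ ℍ

/-- The projection `ℍ → ℍ / Γ`. -/
def proj (Γ : Subgroup PSL(2, ℝ)) (z : ℍ) : Surface Γ := Quotient.mk _ z

/-- The triples `(α, β, z)` of closed geodesics `α`, `β` of `ℍ / Γ` that meet at the point `z` at
the angle `θ`, measured counter-clockwise from `α` to `β`. A closed geodesic, as a subset of
`ℍ / Γ`, is the projection of the axis of a hyperbolic element of `Γ`; the angle is that of two
such axes that cross at a point above `z`. -/
def intersections (Γ : Subgroup PSL(2, ℝ)) (θ : ℝ) :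
    Set (Set (Surface Γ) × Set (Surface Γ) × Surface Γ) :=
  {p | ∃ a ∈ Γ, ∃ b ∈ Γ, IsHyperbolic a ∧ IsHyperbolic b ∧
    ∃ z : ℍ, IsAngle (axis a) (axis b) z θ ∧
      p = (proj Γ '' axis a, proj Γ '' axis b, proj Γ z)}

/-- The multiplicity of `θ` in the angle spectrum of `ℍ / Γ`. -/
def angleMultiplicity (Γ : Subgroup PSL(2, ℝ)) (θ : ℝ) : ℕ∞ := (intersections Γ θ).encard

/-- The set of values of the angle spectrum of `ℍ / Γ`: all angles between closed geodesics
at their intersection points. -/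
def angleSpectrum (Γ : Subgroup PSL(2, ℝ)) : Set ℝ := {θ | (intersections Γ θ).Nonempty}

/-! ### Arithmetic Fuchsian groups -/

section Arithmetic

open NumberField

variable {k : Type} [Field k] {a b : k}

/-- An order of the quaternion algebra `(a, b / k)`: a subring that contains the ring of integers
of `k`, is finitely generated as a module over it, and spans the algebra over `k`. -/
structure IsOrder (O : Subalgebra (𝓞 k) (QuaternionAlgebra k a 0 b)) : Prop where
  fg : (Subalgebra.toSubmodule O).FG
  span_eq_top : Submodule.span k (O : Set (QuaternionAlgebra k a 0 b)) = ⊤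

/-- The group `O¹` of units of `O` whose reduced norm `x * star x` is `1`. -/
def normOneUnits (O : Subalgebra (𝓞 k) (QuaternionAlgebra k a 0 b)) : Subgroup (O)ˣ where
  carrier := {u | ((u : O) : QuaternionAlgebra k a 0 b) * star ((u : O) : QuaternionAlgebra k a 0 b) = 1}
  one_mem' := by simp
  mul_mem' := by
    intro u v hu hv
    simp only [Set.mem_ofPred_eq] at hu hv ⊢
    rw [Units.val_mul, Subalgebra.coe_mul, star_mul, mul_assoc,
      ← mul_assoc ((v : O) : QuaternionAlgebra k a 0 b), hv, one_mul, hu]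
  inv_mem' := by
    intro u hu
    simp only [Set.mem_ofPred_eq] at hu ⊢
    have h1 : (((u⁻¹ : (O)ˣ) : O) : QuaternionAlgebra k a 0 b) * ((u : O) : _) = 1 := by
      rw [← Subalgebra.coe_mul, Units.inv_mul, Subalgebra.coe_one]
    have h2 : (((u⁻¹ : (O)ˣ) : O) : QuaternionAlgebra k a 0 b)
        = star ((u : O) : QuaternionAlgebra k a 0 b) := left_inv_eq_right_inv h1 hu
    rw [h2, star_star, ← h2, h1]

/-- The subgroup `P ρ(O¹)` of `PSL(2, ℝ)`, for a homomorphism `ρ` from the quaternion algebra to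
the real `2 × 2` matrices. (The determinant of `ρ x` is the image of the reduced norm of `x`, so
that `ρ(O¹)` lies in `SL(2, ℝ)`.) -/
def projectiveNormOneUnits (O : Subalgebra (𝓞 k) (QuaternionAlgebra k a 0 b))
    (ρ : QuaternionAlgebra k a 0 b →+* Matrix (Fin 2) (Fin 2) ℝ) : Subgroup PSL(2, ℝ) :=
  (((normOneUnits O).map
      (Units.map ((ρ : QuaternionAlgebra k a 0 b →* Matrix (Fin 2) (Fin 2) ℝ).comp
        (O.val : O →* QuaternionAlgebra k a 0 b)))).comap
    (Matrix.SpecialLinearGroup.toGL (n := Fin 2) (R := ℝ))).map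
    (QuotientGroup.mk' (Subgroup.center SL(2, ℝ)))

end Arithmetic

/-- A Fuchsian group: a discrete subgroup of `PSL(2, ℝ)`. -/
def IsFuchsian (Γ : Subgroup PSL(2, ℝ)) : Prop := DiscreteTopology Γ

/-- A Fuchsian group `Γ` is arithmetic if there are a totally real number field `k` with a real
embedding `σ`, a quaternion algebra `A = (a, b / k)` that is split at `σ` (by `ρ`) and ramified at
every other real place of `k`, and an order `O` of `A`, such that `Γ` is commensurable with
`P ρ(O¹)`. As `ρ` is any `σ`-linear homomorphism, conjugates of these groups are included. -/
def IsArithmeticFuchsian (Γ : Subgroup PSL(2, ℝ)) : Prop :=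
  IsFuchsian Γ ∧
    ∃ (k : Type) (_ : Field k) (_ : NumberField k) (_ : NumberField.IsTotallyReal k)
      (σ : k →+* ℝ) (a b : k) (_ : a ≠ 0) (_ : b ≠ 0)
      (ρ : QuaternionAlgebra k a 0 b →+* Matrix (Fin 2) (Fin 2) ℝ)
      (O : Subalgebra (NumberField.RingOfIntegers k) (QuaternionAlgebra k a 0 b)),
      (∀ x : k, ρ (algebraMap k _ x) = algebraMap ℝ _ (σ x)) ∧
      (∀ τ : k →+* ℝ, τ ≠ σ →
        Nonempty (QuaternionAlgebra ℝ (τ a) 0 (τ b) ≃ₐ[ℝ] Quaternion ℝ)) ∧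
      IsOrder O ∧
      Subgroup.Commensurable Γ (projectiveNormOneUnits O ρ)

end FuchsianAngles

end

open scoped MatrixGroups UpperHalfPlane
open Filter Topology NumberField

namespace FuchsianAngles

/-! An arithmetic group has a large commensurator. If `y` is invertible in the quaternion algebra,
the isometry `g` induced by `ρ y` conjugates some positive power of each element of `Γ` into `Γ`.
Powers keep their axis and isometries preserve angles, so `g` carries a crossing of axes of `Γ` to
another one with the same angle (`exists_mem_intersections`).

To get infinitely many crossings in the quotient, take a power of the first hyperbolic element that
lifts to `A = ρ u` with `u` in `O¹`, and use `y = n + u` for large `n`. The resulting isometries `G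
n` tend to the identity but fix no point, because `n + A` has the same fixed points as the
hyperbolic `A`, both on the boundary. Hence the points `G n • z` tend to `z` without reaching it,
and proper discontinuity puts them in infinitely many `Γ`-orbits (`infinite_range_proj`). -/

/-! ### Displacement functions and axes -/

theorem dist_psl_smul (g : PSL(2, ℝ)) (z w : ℍ) : dist (g • z) (g • w) = dist z w := by
  obtain ⟨A, rfl⟩ := QuotientGroup.mk_surjective g
  rw [mk_smul, mk_smul, dist_smul]

theorem axis_conj (g a : PSL(2, ℝ)) : axis (g * a * g⁻¹) = (g • ·) '' axis a := by
  have key : ∀ z : ℍ, dist z ((g * a * g⁻¹) • z) = dist (g⁻¹ • z) (a • g⁻¹ • z) := fun z => by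
    rw [← dist_psl_smul g⁻¹, smul_smul, smul_smul]; congr 2; group
  ext z
  constructor
  · intro hz
    refine ⟨g⁻¹ • z, fun w => ?_, smul_inv_smul g z⟩
    have := hz (g • w)
    rwa [key, key, inv_smul_smul] at this
  · rintro ⟨w, hw, rfl⟩ v
    simp only [key, inv_smul_smul]
    exact hw _

theorem coe_sl_smul (A : SL(2, ℝ)) (z : ℍ) :
    ((A • z : ℍ) : ℂ) = ((A 0 0 : ℂ) * z + A 0 1) / ((A 1 0 : ℂ) * z + A 1 1) := by
  simpa using UpperHalfPlane.coe_specialLinearGroup_apply A z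

theorem sl_denom_ne_zero (A : SL(2, ℝ)) (z : ℍ) : (A 1 0 : ℂ) * z + A 1 1 ≠ 0 :=
  UpperHalfPlane.denom_ne_zero (A : GL (Fin 2) ℝ) z

/-- The quadratic polynomial whose roots are the fixed points of a matrix. -/
def fixPoly (M : Matrix (Fin 2) (Fin 2) ℝ) (z : ℂ) : ℂ :=
  M 1 0 * z ^ 2 + (M 1 1 - M 0 0) * z - M 0 1

/-- The Hermitian form whose zero set is the geodesic that joins the fixed points of a matrix. -/
def axisForm (M : Matrix (Fin 2) (Fin 2) ℝ) (z : ℂ) : ℝ :=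
  M 1 0 * Complex.normSq z + (M 1 1 - M 0 0) * z.re - M 0 1

theorem normSq_fixPoly (M : Matrix (Fin 2) (Fin 2) ℝ) (z : ℂ) :
    Complex.normSq (fixPoly M z) = axisForm M z ^ 2 + z.im ^ 2 * M.discr := by
  simp only [fixPoly, axisForm, Complex.normSq_apply, Matrix.discr_fin_two, Matrix.trace_fin_two,
    Matrix.det_fin_two, pow_two, Complex.sub_re, Complex.sub_im, Complex.add_re, Complex.add_im,
    Complex.mul_re, Complex.mul_im, Complex.ofReal_re, Complex.ofReal_im]
  ring

theorem fixPoly_ne_zero {M : Matrix (Fin 2) (Fin 2) ℝ} (hM : M.IsHyperbolic) (z : ℍ) :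
    fixPoly M z ≠ 0 := by
  have h : 0 < M.discr := hM
  rw [← Complex.normSq_pos, normSq_fixPoly]
  have : 0 < (z : ℂ).im := z.im_pos
  positivity

theorem sl_smul_sub (A : SL(2, ℝ)) (z : ℍ) :
    ((A • z : ℍ) : ℂ) - z = - fixPoly A z / ((A 1 0 : ℂ) * z + A 1 1) := by
  rw [coe_sl_smul, fixPoly, div_sub' (sl_denom_ne_zero A z)]
  congr 1
  ring

/-- The displacement depends on `z` only through `(axisForm A z / z.im) ^ 2`, so axes can be
compared without computing where the minimum lies. -/
theorem cosh_dist_sl_smul (A : SL(2, ℝ)) (z : ℍ) :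
    Real.cosh (dist z (A • z)) =
      1 + ((axisForm A z / z.im) ^ 2 + (A : Matrix (Fin 2) (Fin 2) ℝ).discr) / 2 := by
  have hd := sl_denom_ne_zero A z
  have him : (A • z : ℍ).im = z.im / Complex.normSq ((A 1 0 : ℂ) * z + A 1 1) := by
    refine (UpperHalfPlane.im_smul_eq_div_normSq (A : GL (Fin 2) ℝ) z).trans ?_
    simp [UpperHalfPlane.denom]
  have hn := (Complex.normSq_pos.2 hd).ne'
  have hz := z.im_pos.ne'
  rw [UpperHalfPlane.cosh_dist, dist_comm, dist_eq_norm, sl_smul_sub, ← Complex.normSq_eq_norm_sq,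
    him, Complex.normSq_div, Complex.normSq_neg, normSq_fixPoly, UpperHalfPlane.coe_im]
  field_simp

theorem mem_axis_mk_iff (A : SL(2, ℝ)) (z : ℍ) :
    z ∈ axis (A : PSL(2, ℝ)) ↔
      ∀ w : ℍ, (axisForm A z / z.im) ^ 2 ≤ (axisForm A w / w.im) ^ 2 := by
  refine forall_congr' fun w => ?_
  rw [mk_smul, mk_smul, ← abs_of_nonneg (dist_nonneg (x := z)), ← abs_of_nonneg (dist_nonneg (x := w)),
    ← Real.cosh_le_cosh, cosh_dist_sl_smul, cosh_dist_sl_smul]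
  constructor <;> intro h <;> linarith

/-- Scalar matrices do not contribute to `axisForm`, and the factor `q ^ 2` leaves the minimizers
unchanged. -/
theorem axis_eq_of_eq_add {A B : SL(2, ℝ)} {p q : ℝ} (hq : q ≠ 0)
    (h : (B : Matrix (Fin 2) (Fin 2) ℝ) = p • 1 + q • (A : Matrix (Fin 2) (Fin 2) ℝ)) :
    axis (B : PSL(2, ℝ)) = axis (A : PSL(2, ℝ)) := by
  have key : ∀ z : ℂ, axisForm B z = q * axisForm A z := fun z => by
    simp [axisForm, h]; ring
  ext z
  rw [mem_axis_mk_iff, mem_axis_mk_iff]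
  refine forall_congr' fun w => ?_
  rw [key, key, mul_div_assoc, mul_div_assoc, mul_pow, mul_pow]
  exact mul_le_mul_iff_right₀ (by positivity)

theorem discr_of_eq_add {A B : Matrix (Fin 2) (Fin 2) ℝ} {p q : ℝ} (h : B = p • 1 + q • A) :
    B.discr = q ^ 2 * A.discr := by
  simp [Matrix.discr_fin_two, Matrix.trace_fin_two, Matrix.det_fin_two, h]
  ring

theorem sl_sq_eq (A : SL(2, ℝ)) :
    (A : Matrix (Fin 2) (Fin 2) ℝ) * A = (A : Matrix (Fin 2) (Fin 2) ℝ).trace • (A : Matrix (Fin 2) (Fin 2) ℝ) - 1 := by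
  have h := A.det_coe
  rw [Matrix.det_fin_two] at h
  ext i j
  fin_cases i <;> fin_cases j <;>
    simp [Matrix.mul_apply, Fin.sum_univ_two, Matrix.trace_fin_two] <;>
    first | ring1 | linear_combination h | linear_combination -h

/-! ### Powers and conjugates of hyperbolic elements -/

/-- Cayley-Hamilton gives the recursion `(p, q) ↦ (-q, p + q * trace)`. The inequalities are the
invariant that keeps `q` positive when the trace exceeds `2`. -/
theorem exists_pow_eq_add_of_two_lt_trace {A : SL(2, ℝ)}
    (hA : 2 < (A : Matrix (Fin 2) (Fin 2) ℝ).trace) (m : ℕ) :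
    ∃ p q : ℝ, 0 ≤ -p ∧ -p < q ∧
      (A : Matrix (Fin 2) (Fin 2) ℝ) ^ (m + 1) = p • 1 + q • (A : Matrix (Fin 2) (Fin 2) ℝ) := by
  induction m with
  | zero => exact ⟨0, 1, by simp, by simp, by simp⟩
  | succ m ih =>
    obtain ⟨p, q, hp, hpq, h⟩ := ih
    refine ⟨-q, p + q * (A : Matrix (Fin 2) (Fin 2) ℝ).trace, by linarith, by nlinarith, ?_⟩
    rw [pow_succ, h, add_mul, smul_mul_assoc, smul_mul_assoc, sl_sq_eq, one_mul]
    module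

theorem IsHyperbolic.exists_two_lt_trace {g : PSL(2, ℝ)} (hg : IsHyperbolic g) :
    ∃ A : SL(2, ℝ), (A : PSL(2, ℝ)) = g ∧ 2 < (A : Matrix (Fin 2) (Fin 2) ℝ).trace := by
  obtain ⟨A, rfl, hA⟩ := hg
  have h : 4 < (A : Matrix (Fin 2) (Fin 2) ℝ).trace ^ 2 := by
    have h : 0 < (A : Matrix (Fin 2) (Fin 2) ℝ).discr := hA
    rw [Matrix.discr_fin_two, A.det_coe] at h
    linarith
  rcases lt_or_ge 2 (A : Matrix (Fin 2) (Fin 2) ℝ).trace with h2 | h2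
  · exact ⟨A, rfl, h2⟩
  · refine ⟨-A, ?_, ?_⟩
    · rw [QuotientGroup.eq]
      rw [Subgroup.mem_center_iff]
      intro B
      have : (-A)⁻¹ * A = -1 := by
        rw [inv_mul_eq_iff_eq_mul]; simp
      rw [this]; simp
    · rw [Matrix.SpecialLinearGroup.coe_neg, Matrix.trace_neg]
      nlinarith

theorem IsHyperbolic.of_mk {A : SL(2, ℝ)} (hA : IsHyperbolic (A : PSL(2, ℝ))) :
    (A : Matrix (Fin 2) (Fin 2) ℝ).IsHyperbolic := by
  obtain ⟨B, hB, hBh⟩ := hA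
  obtain ⟨r, hr, h⟩ := Matrix.SpecialLinearGroup.mem_center_iff.1 (QuotientGroup.eq.1 hB)
  have hA : (A : Matrix (Fin 2) (Fin 2) ℝ) = (0 : ℝ) • 1 + r • (B : Matrix (Fin 2) (Fin 2) ℝ) := by
    rw [zero_smul, zero_add, ← mul_inv_cancel_left B A, Matrix.SpecialLinearGroup.coe_mul, ← h,
      Matrix.scalar_apply, ← Matrix.smul_eq_mul_diagonal]
  have hr : r ^ 2 = 1 := by simpa using hr
  have h : 0 < (B : Matrix (Fin 2) (Fin 2) ℝ).discr := hBh
  change 0 < Matrix.discr _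
  rwa [discr_of_eq_add hA, hr, one_mul]

theorem IsHyperbolic.of_two_lt_trace {A : SL(2, ℝ)}
    (hA : 2 < (A : Matrix (Fin 2) (Fin 2) ℝ).trace) :
    (A : Matrix (Fin 2) (Fin 2) ℝ).IsHyperbolic := by
  change 0 < (A : Matrix (Fin 2) (Fin 2) ℝ).discr
  rw [Matrix.discr_fin_two, A.det_coe]
  nlinarith

theorem IsHyperbolic.pow {g : PSL(2, ℝ)} (hg : IsHyperbolic g) {m : ℕ} (hm : 0 < m) :
    IsHyperbolic (g ^ m) ∧ axis (g ^ m) = axis g := by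
  obtain ⟨A, rfl, hA⟩ := hg.exists_two_lt_trace
  obtain ⟨m, rfl⟩ := Nat.exists_eq_succ_of_ne_zero hm.ne'
  obtain ⟨p, q, hp, hpq, h⟩ := exists_pow_eq_add_of_two_lt_trace hA m
  have hq : q ≠ 0 := by linarith
  rw [← Matrix.SpecialLinearGroup.coe_pow] at h
  refine ⟨⟨A ^ (m + 1), rfl, ?_⟩, axis_eq_of_eq_add hq h⟩
  change 0 < Matrix.discr _
  rw [discr_of_eq_add h]
  have : 0 < (A : Matrix (Fin 2) (Fin 2) ℝ).discr := IsHyperbolic.of_two_lt_trace hA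
  positivity

theorem IsHyperbolic.conj {a : PSL(2, ℝ)} (ha : IsHyperbolic a) (g : PSL(2, ℝ)) :
    IsHyperbolic (g * a * g⁻¹) := by
  obtain ⟨A, rfl, hA⟩ := ha
  obtain ⟨G, rfl⟩ := QuotientGroup.mk_surjective g
  refine ⟨G * A * G⁻¹, rfl, ?_⟩
  change 0 < Matrix.discr _
  have h : ((G * A * G⁻¹ : SL(2, ℝ)) : Matrix (Fin 2) (Fin 2) ℝ).trace =
      (A : Matrix (Fin 2) (Fin 2) ℝ).trace := by
    rw [mul_assoc, Matrix.SpecialLinearGroup.coe_mul, Matrix.trace_mul_comm,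
      ← Matrix.SpecialLinearGroup.coe_mul, inv_mul_cancel_right]
  replace hA : 0 < Matrix.discr (A : Matrix (Fin 2) (Fin 2) ℝ) := hA
  rw [Matrix.discr_fin_two, Matrix.SpecialLinearGroup.det_coe] at hA ⊢
  rwa [h]

/-! ### Invariance of angles -/

/-- The divisor comes from the derivative `1 / (c z + d) ^ 2` of a Moebius map. It is the same for
all tangent vectors at `z`, hence conformality. -/
theorem IsUnitTangent.smul {L : Set ℍ} {z : ℍ} {v : ℂ} (h : IsUnitTangent L z v) (G : SL(2, ℝ)) :
    IsUnitTangent (((G : PSL(2, ℝ)) • ·) '' L) ((G : PSL(2, ℝ)) • z)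
      (v / ((G 1 0 : ℂ) * z + G 1 1) ^ 2) := by
  obtain ⟨c, hc, rfl, rfl, hv⟩ := h
  refine ⟨fun t => (G : PSL(2, ℝ)) • c t, ?_, ?_, rfl, ?_⟩
  · exact Isometry.of_dist_eq fun s t => by rw [dist_psl_smul, hc.dist_eq]
  · rw [← Set.range_comp]; rfl
  · have hd := sl_denom_ne_zero G (c 0)
    have hdet : (G 0 0 : ℂ) * G 1 1 - G 0 1 * G 1 0 = 1 := by
      have := G.det_coe
      rw [Matrix.det_fin_two] at this
      exact_mod_cast this
    simp only [mk_smul, coe_sl_smul]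
    have h := ((hv.const_mul (G 0 0 : ℂ)).add_const (G 0 1 : ℂ)).fun_div
      ((hv.const_mul (G 1 0 : ℂ)).add_const (G 1 1 : ℂ)) hd
    refine h.congr_deriv (congrArg (· / ((G 1 0 : ℂ) * c 0 + G 1 1) ^ 2) ?_)
    linear_combination v * hdet

theorem IsAngle.smul {L M : Set ℍ} {z : ℍ} {θ : ℝ} (h : IsAngle L M z θ) (g : PSL(2, ℝ)) :
    IsAngle ((g • ·) '' L) ((g • ·) '' M) (g • z) θ := by
  obtain ⟨hθ, v, w, hv, hw, rfl⟩ := h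
  obtain ⟨G, rfl⟩ := QuotientGroup.mk_surjective g
  exact ⟨hθ, _, _, hv.smul G, hw.smul G, by rw [mul_div_assoc]⟩

/-- An element `g` such that every element of `Γ` has a positive power that `g` conjugates into `Γ`
maps intersection points to intersection points with the same angle. -/
theorem exists_mem_intersections {Γ : Subgroup PSL(2, ℝ)} {g a b : PSL(2, ℝ)} {z : ℍ} {θ : ℝ}
    (hg : ∀ x ∈ Γ, ∃ m : ℕ, 0 < m ∧ g * x ^ m * g⁻¹ ∈ Γ)
    (ha : a ∈ Γ) (hb : b ∈ Γ) (hah : IsHyperbolic a) (hbh : IsHyperbolic b)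
    (h : IsAngle (axis a) (axis b) z θ) :
    ∃ p ∈ intersections Γ θ, p.2.2 = proj Γ (g • z) := by
  obtain ⟨m, hm, hma⟩ := hg a ha
  obtain ⟨n, hn, hnb⟩ := hg b hb
  refine ⟨_, ⟨_, hma, _, hnb, (hah.pow hm).1.conj g, (hbh.pow hn).1.conj g, g • z, ?_, rfl⟩, rfl⟩
  rw [axis_conj, axis_conj, (hah.pow hm).2, (hbh.pow hn).2]
  exact h.smul g

/-! ### Proper discontinuity -/

theorem isClosed_center_sl : IsClosed (Subgroup.center SL(2, ℝ) : Set SL(2, ℝ)) := by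
  have : (Subgroup.center SL(2, ℝ) : Set SL(2, ℝ)) = ⋂ B : SL(2, ℝ), {A | B * A = A * B} := by
    ext A; simp [Subgroup.mem_center_iff]
  rw [this]
  exact isClosed_iInter fun B => isClosed_eq (by fun_prop) (by fun_prop)

/-- A Fuchsian group acts properly discontinuously. -/
theorem IsFuchsian.finite_setOf_inter_nonempty {Γ : Subgroup PSL(2, ℝ)} (hΓ : IsFuchsian Γ)
    {K : Set ℍ} (hK : IsCompact K) :
    {g : PSL(2, ℝ) | g ∈ Γ ∧ ∃ z ∈ K, g • z ∈ K}.Finite := by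
  have : DiscreteTopology Γ := hΓ
  have := isClosed_center_sl
  -- `SL(2, ℝ)` acts properly, so the elements that bring `K` back to itself form a compact set; the
  -- discrete `Γ` meets its image in a finite set.
  have hC := ProperSMul.isCompact_setOfPred_inter_nonempty (G := SL(2, ℝ)) hK hK
  have hC' := hC.image (f := ((↑) : SL(2, ℝ) → PSL(2, ℝ))) QuotientGroup.continuous_mk
  have ht := Γ.tendsto_coe_cofinite_of_discrete (isDiscrete_iff_discreteTopology.2 hΓ)
  have hfin := ht hC'.compl_mem_cocompact
  rw [mem_map, mem_cofinite] at hfin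
  refine (hfin.image ((↑) : Γ → PSL(2, ℝ))).subset ?_
  rintro g ⟨hg, z, hz, hgz⟩
  refine ⟨⟨g, hg⟩, ?_, rfl⟩
  obtain ⟨A, rfl⟩ := QuotientGroup.mk_surjective g
  rw [mk_smul] at hgz
  simp only [Set.mem_compl_iff, Set.mem_preimage, not_not]
  exact ⟨A, ⟨A • z, ⟨z, hz, rfl⟩, hgz⟩, rfl⟩

theorem IsFuchsian.infinite_range_proj {Γ : Subgroup PSL(2, ℝ)} (hΓ : IsFuchsian Γ)
    {z : ℍ} {s : ℕ → ℍ} (hs : Tendsto s atTop (𝓝 z)) (hne : ∀ n, s n ≠ z) :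
    (Set.range fun n => proj Γ (s n)).Infinite := by
  intro hfin
  obtain ⟨K, hK, hKz⟩ := exists_compact_mem_nhds z
  obtain ⟨N, hN⟩ := eventually_atTop.1 (hs hKz)
  have hF := hΓ.finite_setOf_inter_nonempty hK
  set F := {g : PSL(2, ℝ) | g ∈ Γ ∧ ∃ z ∈ K, g • z ∈ K}
  have hfin' : (Set.range fun n => proj Γ (s (n + N))).Finite :=
    hfin.subset (by rintro _ ⟨n, rfl⟩; exact ⟨n + N, rfl⟩)
  obtain ⟨T, hT⟩ : ∃ T : Set ℕ, T.Finite ∧ ∀ n, ∃ m ∈ T, proj Γ (s (n + N)) = proj Γ (s (m + N)) := by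
    rw [← Set.image_univ] at hfin'
    obtain ⟨T, -, hT, hT2⟩ := hfin'.exists_subset_finite_image_eq subset_rfl
    refine ⟨T, hT, fun n => ?_⟩
    obtain ⟨m, hm, h⟩ := hT2.symm.subset (Set.mem_image_of_mem _ (Set.mem_univ n))
    exact ⟨m, hm, h.symm⟩
  -- With finitely many orbits, the tail of the sequence lies in finitely many translates, by
  -- elements of `F`, of orbit representatives.
  have hX : (⋃ m ∈ T, (fun g : PSL(2, ℝ) => g • s (m + N)) '' F).Finite :=
    hT.1.biUnion fun m _ => hF.image _
  set X := ⋃ m ∈ T, (fun g : PSL(2, ℝ) => g • s (m + N)) '' F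
  have hmem : ∀ n, s (n + N) ∈ X := by
    intro n
    obtain ⟨m, hm, h⟩ := hT.2 n
    obtain ⟨g, hg⟩ := MulAction.orbitRel_apply.1 (Quotient.exact h)
    refine Set.mem_biUnion hm ⟨g, ⟨g.2, s (m + N), hN _ (by omega), ?_⟩, hg⟩
    have : (g : PSL(2, ℝ)) • s (m + N) = s (n + N) := hg
    rw [this]
    exact hN _ (by omega)
  -- A finite set without `z` is closed, so it cannot contain a sequence that tends to `z`.
  have hcl : IsClosed (X \ {z}) := (hX.subset Set.sdiff_subset).isClosed
  have := hcl.mem_of_tendsto ((tendsto_add_atTop_iff_nat N).2 hs)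
    (Eventually.of_forall fun n => ⟨hmem n, hne _⟩)
  exact this.2 rfl

/-! ### Orders and the commensurator -/

section Orders

variable {k : Type} [Field k] {a b : k}

theorem IsOrder.exists_nsmul_mem [NumberField k] {O : Subalgebra (𝓞 k) (QuaternionAlgebra k a 0 b)}
    (hO : IsOrder O) (x : QuaternionAlgebra k a 0 b) : ∃ N : ℕ, N ≠ 0 ∧ N • x ∈ O := by
  have hx : x ∈ Submodule.span k (O : Set (QuaternionAlgebra k a 0 b)) := by
    rw [hO.span_eq_top]; trivial
  induction hx using Submodule.span_induction with
  | mem x hx => exact ⟨1, one_ne_zero, by simpa using hx⟩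
  | zero => exact ⟨1, one_ne_zero, by simp⟩
  | add x y _ _ hx hy =>
    obtain ⟨M, hM, hMx⟩ := hx
    obtain ⟨N, hN, hNy⟩ := hy
    refine ⟨M * N, mul_ne_zero hM hN, ?_⟩
    rw [smul_add, mul_comm, mul_smul, mul_comm, mul_smul]
    exact add_mem (nsmul_mem hMx N) (nsmul_mem hNy M)
  | smul c x _ hx =>
    obtain ⟨M, hM, hMx⟩ := hx
    have hc : IsAlgebraic ℤ c := (IsFractionRing.isAlgebraic_iff ℤ ℚ k).2 (Algebra.IsAlgebraic.isAlgebraic c)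
    obtain ⟨N, hN, hNc⟩ := hc.exists_integral_multiple
    have hNc' : IsIntegral ℤ (N.natAbs • c) := by
      rcases Int.natAbs_eq N with h | h
      · rw [h] at hNc; simpa using hNc
      · rw [h] at hNc; simpa using hNc.neg
    refine ⟨N.natAbs * M, mul_ne_zero (by simpa using hN) hM, ?_⟩
    have : (N.natAbs * M) • c • x = (⟨N.natAbs • c, hNc'⟩ : 𝓞 k) • (M • x) := by
      change _ = (N.natAbs • c) • (M • x)
      rw [smul_assoc, smul_comm c M, mul_smul]
    rw [this]
    exact O.smul_mem hMx _

/-- A common denominator for the finitely many module generators of `O` works for all of `O`. -/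
theorem IsOrder.exists_nsmul_conj_mem [NumberField k]
    {O : Subalgebra (𝓞 k) (QuaternionAlgebra k a 0 b)}
    (hO : IsOrder O) (y y' : QuaternionAlgebra k a 0 b) :
    ∃ N : ℕ, N ≠ 0 ∧ ∀ w ∈ O, N • (y * w * y') ∈ O := by
  obtain ⟨S, hS⟩ := hO.fg
  choose N hN hNm using fun s => hO.exists_nsmul_mem (y * s * y')
  refine ⟨∏ s ∈ S, N s, Finset.prod_ne_zero_iff.2 fun s _ => hN s, fun w hw => ?_⟩
  rw [← Subalgebra.mem_toSubmodule, ← hS] at hw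
  induction hw using Submodule.span_induction with
  | mem x hx =>
    obtain ⟨c, hc⟩ := Finset.dvd_prod_of_mem N hx
    rw [hc, mul_comm, mul_smul]
    exact nsmul_mem (hNm x) c
  | zero => simp
  | add x z _ _ hx hz =>
    rw [mul_add, add_mul, smul_add]
    exact add_mem hx hz
  | smul c x _ hx =>
    rw [Algebra.smul_def c, ← mul_assoc, ← Algebra.commutes, mul_assoc, mul_assoc, ← mul_smul_comm,
      ← mul_assoc y]
    exact mul_mem (O.algebraMap_mem c) hx

/-- Units of an order have finite order modulo every positive integer. -/
theorem IsOrder.exists_pow_eq_one_add [NumberField k]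
    {O : Subalgebra (𝓞 k) (QuaternionAlgebra k a 0 b)}
    (hO : IsOrder O) {N : ℕ} (hN : N ≠ 0) (u : (O)ˣ) :
    ∃ m : ℕ, 0 < m ∧ ∃ w : O, ((u ^ m : (O)ˣ) : O) = 1 + N • w := by
  have h1 : Module.Finite (𝓞 k) O := Module.Finite.iff_fg.2 hO.fg
  have h2 : Module.Finite ℤ O := Module.Finite.trans (𝓞 k) O
  let R : Submodule ℤ O := LinearMap.range (LinearMap.lsmul ℤ O N)
  have hfin : Finite (O ⧸ R) := by
    refine Module.finite_of_fg_torsion _ fun {x} => ?_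
    obtain ⟨x, rfl⟩ := R.mkQ_surjective x
    refine ⟨⟨(N : ℤ), by simpa using hN⟩, ?_⟩
    change (N : ℤ) • R.mkQ x = 0
    rw [← map_smul]
    exact (Submodule.Quotient.mk_eq_zero R).2 ⟨x, rfl⟩
  -- Pigeonhole in the finite group `O / N O`.
  obtain ⟨i, j, hij, h⟩ : ∃ i j : ℕ, i < j ∧
      R.mkQ ((u ^ i : (O)ˣ) : O) = R.mkQ ((u ^ j : (O)ˣ) : O) := by
    obtain ⟨i, j, hne, h⟩ := Finite.exists_ne_map_eq_of_infinite
      fun i : ℕ => R.mkQ ((u ^ i : (O)ˣ) : O)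
    rcases hne.lt_or_gt with hl | hl
    · exact ⟨i, j, hl, h⟩
    · exact ⟨j, i, hl, h.symm⟩
  obtain ⟨w, hw⟩ := (Submodule.Quotient.eq R).1 h.symm
  have hw' : ((u ^ j : (O)ˣ) : O) = ((u ^ i : (O)ˣ) : O) + N • w := by
    rw [← sub_eq_iff_eq_add', ← hw]; simp
  refine ⟨j - i, by omega, ((u ^ i)⁻¹ : (O)ˣ) * w, ?_⟩
  have : u ^ (j - i) = (u ^ i)⁻¹ * u ^ j := by
    rw [eq_inv_mul_iff_mul_eq, ← pow_add]; congr 1; omega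
  rw [this, Units.val_mul, hw', mul_add, Units.inv_mul, mul_smul_comm]

/-- If `N` clears the denominators of `y * O * y'` and `u ^ m = 1 + N • w`, then `y * u ^ m * y' = 1
+ N • (y * w * y')` lies in `O`. -/
theorem exists_unit_eq_conj [NumberField k] {O : Subalgebra (𝓞 k) (QuaternionAlgebra k a 0 b)}
    (hO : IsOrder O) {y y' : QuaternionAlgebra k a 0 b} (hy : y * y' = 1) (hy' : y' * y = 1)
    {u : (O)ˣ} (hu : u ∈ normOneUnits O) :
    ∃ m : ℕ, 0 < m ∧ ∃ w ∈ normOneUnits O,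
      ((w : O) : QuaternionAlgebra k a 0 b) = y * ((u : O) : QuaternionAlgebra k a 0 b) ^ m * y' := by
  obtain ⟨N, hN, hNm⟩ := hO.exists_nsmul_conj_mem y y'
  obtain ⟨m, hm, w, hw⟩ := hO.exists_pow_eq_one_add hN u
  have hconj : ∀ x : O, y * ((1 + N • x : O) : QuaternionAlgebra k a 0 b) * y' ∈ O := fun x => by
    have : y * ((1 + N • x : O) : QuaternionAlgebra k a 0 b) * y' =
        1 + N • (y * (x : QuaternionAlgebra k a 0 b) * y') := by
      push_cast
      rw [mul_add, add_mul, mul_one, hy, mul_smul_comm, smul_mul_assoc]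
    rw [this]
    exact add_mem (one_mem _) (hNm _ x.2)
  -- The inverse is also `1` modulo `N`, so its conjugate lies in `O` too and the conjugate of `u ^
  -- m` is a unit.
  have hinv : (((u ^ m)⁻¹ : (O)ˣ) : O) = 1 + N • (-(((u ^ m)⁻¹ : (O)ˣ) : O) * w) := by
    have := (u ^ m).inv_mul
    rw [hw, mul_add, mul_one, mul_smul_comm] at this
    rw [neg_mul, smul_neg, ← this]
    abel
  have hcancel : ∀ p q : O, p * q = 1 →
      (y * (p : QuaternionAlgebra k a 0 b) * y') * (y * (q : QuaternionAlgebra k a 0 b) * y') = 1 := by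
    intro p q hpq
    have hpq' : (p : QuaternionAlgebra k a 0 b) * q = 1 := by rw [← Subalgebra.coe_mul, hpq]; rfl
    calc _ = y * (p * ((y' * y) * q)) * y' := by simp only [mul_assoc]
      _ = 1 := by rw [hy', one_mul, hpq', mul_one, hy]
  refine ⟨m, hm, ⟨⟨y * (((u ^ m : (O)ˣ) : O) : QuaternionAlgebra k a 0 b) * y', hw ▸ hconj w⟩,
    ⟨y * ((((u ^ m)⁻¹ : (O)ˣ) : O) : QuaternionAlgebra k a 0 b) * y', hinv ▸ hconj _⟩,
    Subtype.ext (hcancel _ _ (Units.mul_inv _)), Subtype.ext (hcancel _ _ (Units.inv_mul _))⟩, ?_, by simp⟩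
  have hum : (((u ^ m : (O)ˣ) : O) : QuaternionAlgebra k a 0 b) *
    star (((u ^ m : (O)ˣ) : O) : QuaternionAlgebra k a 0 b) = 1 := pow_mem hu m
  set v := (((u ^ m : (O)ˣ) : O) : QuaternionAlgebra k a 0 b)
  change y * v * y' * star (y * v * y') = 1
  -- The reduced norm of `y'` is a scalar, hence can be moved past `v`.
  obtain ⟨c, hc⟩ : ∃ c : k, y' * star y' = algebraMap k _ c :=
    ⟨_, QuaternionAlgebra.mul_star_eq_coe y'⟩
  calc _ = y * v * (y' * star y') * (star v * star y) := by simp only [star_mul, mul_assoc]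
    _ = y * (y' * star y') * (v * star v) * star y := by
        rw [hc, mul_assoc y v, ← Algebra.commutes c v]; simp only [mul_assoc]
    _ = (y * y') * star (y * y') := by rw [hum, star_mul]; simp only [mul_assoc, one_mul]
    _ = 1 := by rw [hy, star_one, one_mul]

theorem mem_projectiveNormOneUnits_iff {O : Subalgebra (𝓞 k) (QuaternionAlgebra k a 0 b)}
    {ρ : QuaternionAlgebra k a 0 b →+* Matrix (Fin 2) (Fin 2) ℝ} {x : PSL(2, ℝ)} :
    x ∈ projectiveNormOneUnits O ρ ↔ ∃ u ∈ normOneUnits O, ∃ A : SL(2, ℝ),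
      (A : Matrix (Fin 2) (Fin 2) ℝ) = ρ ((u : O) : QuaternionAlgebra k a 0 b) ∧
        (A : PSL(2, ℝ)) = x := by
  constructor
  · rintro ⟨A, ⟨u, hu, h⟩, rfl⟩
    exact ⟨u, hu, A, (congrArg Units.val h).symm, rfl⟩
  · rintro ⟨u, hu, A, h, rfl⟩
    exact ⟨A, ⟨u, hu, Units.ext h.symm⟩, rfl⟩

/-- The image of an invertible element of the quaternion algebra commensurates `P ρ(O¹)`, at the
level of cyclic subgroups. -/
theorem exists_conj_pow_mem_projectiveNormOneUnits [NumberField k]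
    {O : Subalgebra (𝓞 k) (QuaternionAlgebra k a 0 b)} (hO : IsOrder O)
    {ρ : QuaternionAlgebra k a 0 b →+* Matrix (Fin 2) (Fin 2) ℝ}
    {y y' : QuaternionAlgebra k a 0 b} (hy : y * y' = 1) (hy' : y' * y = 1)
    {G : SL(2, ℝ)} {r : ℝ} (hG : ρ y = r • (G : Matrix (Fin 2) (Fin 2) ℝ))
    {x : PSL(2, ℝ)} (hx : x ∈ projectiveNormOneUnits O ρ) :
    ∃ m : ℕ, 0 < m ∧ (G : PSL(2, ℝ)) * x ^ m * (G : PSL(2, ℝ))⁻¹ ∈ projectiveNormOneUnits O ρ := by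
  obtain ⟨u, hu, A, hA, rfl⟩ := mem_projectiveNormOneUnits_iff.1 hx
  obtain ⟨m, hm, w, hw, hwu⟩ := exists_unit_eq_conj hO hy hy' hu
  refine ⟨m, hm, mem_projectiveNormOneUnits_iff.2 ⟨w, hw, G * A ^ m * G⁻¹, ?_, rfl⟩⟩
  have h : ((G * A ^ m * G⁻¹ : SL(2, ℝ)) : Matrix (Fin 2) (Fin 2) ℝ) * ρ y =
      ρ (y * ((u : O) : QuaternionAlgebra k a 0 b) ^ m) := by
    rw [map_mul, map_pow, hG, ← hA, mul_smul_comm, smul_mul_assoc,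
      ← Matrix.SpecialLinearGroup.coe_mul, inv_mul_cancel_right]
    simp
  have h1 : ρ y * ρ y' = 1 := by rw [← map_mul, hy, map_one]
  rw [hwu, map_mul, ← h, Matrix.mul_assoc, h1, Matrix.mul_one]

theorem exists_conj_pow_mem_of_commensurable [NumberField k] {Γ : Subgroup PSL(2, ℝ)}
    {O : Subalgebra (𝓞 k) (QuaternionAlgebra k a 0 b)} (hO : IsOrder O)
    {ρ : QuaternionAlgebra k a 0 b →+* Matrix (Fin 2) (Fin 2) ℝ}
    (hΓ : Subgroup.Commensurable Γ (projectiveNormOneUnits O ρ))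
    {y y' : QuaternionAlgebra k a 0 b} (hy : y * y' = 1) (hy' : y' * y = 1)
    {G : SL(2, ℝ)} {r : ℝ} (hG : ρ y = r • (G : Matrix (Fin 2) (Fin 2) ℝ))
    {x : PSL(2, ℝ)} (hx : x ∈ Γ) :
    ∃ m : ℕ, 0 < m ∧ (G : PSL(2, ℝ)) * x ^ m * (G : PSL(2, ℝ))⁻¹ ∈ Γ := by
  obtain ⟨l, hl, -, hxl⟩ := Subgroup.exists_pow_mem_of_relIndex_ne_zero hΓ.2 hx
  obtain ⟨m, hm, h⟩ := exists_conj_pow_mem_projectiveNormOneUnits hO hy hy' hG hxl.1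
  obtain ⟨n, hn, -, hn'⟩ := Subgroup.exists_pow_mem_of_relIndex_ne_zero hΓ.1 h
  refine ⟨l * m * n, by positivity, ?_⟩
  rw [pow_mul, pow_mul, ← conj_pow]
  exact hn'.1

end Orders

/-! ### The isometries induced by `x + A` -/

theorem eventually_sq_add_mul_add_one_pos (c : ℝ) :
    ∀ᶠ n : ℕ in atTop, 0 < (n : ℝ) ^ 2 + n * c + 1 := by
  filter_upwards [tendsto_natCast_atTop_atTop.eventually_ge_atTop (-c)] with n hn
  nlinarith [Nat.cast_nonneg (α := ℝ) n]

theorem denom_eq_of_smul_eq {G A : SL(2, ℝ)} {r x : ℝ}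
    (h : r • (G : Matrix (Fin 2) (Fin 2) ℝ) = x • 1 + (A : Matrix (Fin 2) (Fin 2) ℝ)) (z : ℍ) :
    (A 1 0 : ℂ) * z + A 1 1 + x = r * ((G 1 0 : ℂ) * z + G 1 1) := by
  have e10 : r * G 1 0 = A 1 0 := by simpa using congrFun (congrFun h 1) 0
  have e11 : r * G 1 1 = x + A 1 1 := by simpa using congrFun (congrFun h 1) 1
  rw [← e10, mul_add, ← mul_assoc, ← Complex.ofReal_mul r (G 1 1), e11]
  push_cast
  ring

theorem fixPoly_eq_of_smul_eq {G A : SL(2, ℝ)} {r x : ℝ}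
    (h : r • (G : Matrix (Fin 2) (Fin 2) ℝ) = x • 1 + (A : Matrix (Fin 2) (Fin 2) ℝ)) (z : ℂ) :
    r * fixPoly G z = fixPoly A z := by
  have e : ∀ i j, (r : ℂ) * G i j = ((x • 1 + (A : Matrix (Fin 2) (Fin 2) ℝ)) i j : ℝ) :=
    fun i j => by rw [← h]; simp
  rw [fixPoly, mul_sub, mul_add, ← mul_assoc, ← mul_assoc, mul_sub, e, e, e, e]
  simp [fixPoly]

/-- The numerator does not involve `x` and vanishes nowhere on the half-plane for hyperbolic `A`:
the displacement is nonzero and tends to `0` as `x` grows. -/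
theorem sl_smul_sub_of_smul_eq {G A : SL(2, ℝ)} {r x : ℝ} (hr : r ≠ 0)
    (h : r • (G : Matrix (Fin 2) (Fin 2) ℝ) = x • 1 + (A : Matrix (Fin 2) (Fin 2) ℝ)) (z : ℍ) :
    ((G • z : ℍ) : ℂ) - z = - fixPoly A z / ((A 1 0 : ℂ) * z + A 1 1 + x) := by
  rw [sl_smul_sub, denom_eq_of_smul_eq h, ← fixPoly_eq_of_smul_eq h, ← mul_neg,
    mul_div_mul_left _ _ (by exact_mod_cast hr)]

theorem sl_smul_ne_of_smul_eq {G A : SL(2, ℝ)} {r x : ℝ} (hr : r ≠ 0)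
    (h : r • (G : Matrix (Fin 2) (Fin 2) ℝ) = x • 1 + (A : Matrix (Fin 2) (Fin 2) ℝ))
    (hA : (A : Matrix (Fin 2) (Fin 2) ℝ).IsHyperbolic) (z : ℍ) : G • z ≠ z := by
  intro hz
  have := sl_smul_sub_of_smul_eq hr h z
  rw [hz, sub_self, eq_comm, div_eq_zero_iff, neg_eq_zero, denom_eq_of_smul_eq h] at this
  rcases this with h' | h'
  · exact fixPoly_ne_zero hA z h'
  · exact mul_ne_zero (by exact_mod_cast hr) (sl_denom_ne_zero G z) h'

theorem tendsto_sl_smul {G : ℕ → SL(2, ℝ)} {A : SL(2, ℝ)} {r x : ℕ → ℝ} (hr : ∀ n, r n ≠ 0)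
    (h : ∀ n, r n • (G n : Matrix (Fin 2) (Fin 2) ℝ) = x n • 1 + (A : Matrix (Fin 2) (Fin 2) ℝ))
    (hx : Tendsto x atTop atTop) (z : ℍ) : Tendsto (fun n => G n • z) atTop (𝓝 z) := by
  rw [UpperHalfPlane.isEmbedding_coe.tendsto_nhds_iff, tendsto_iff_norm_sub_tendsto_zero]
  simp only [Function.comp_apply, sl_smul_sub_of_smul_eq (hr _) (h _), norm_div]
  refine Tendsto.div_atTop tendsto_const_nhds ?_
  have hx' : Tendsto (fun n => ‖(x n : ℂ)‖ - ‖(A 1 0 : ℂ) * z + A 1 1‖) atTop atTop :=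
    tendsto_atTop_add_const_right _ _ (by simpa [Function.comp_def] using tendsto_abs_atTop_atTop.comp hx)
  refine tendsto_atTop_mono (fun n => ?_) hx'
  have := norm_sub_norm_le (x n : ℂ) (-((A 1 0 : ℂ) * z + A 1 1))
  rwa [norm_neg, sub_neg_eq_add, add_comm (x n : ℂ)] at this

theorem exists_sl_smul_eq {A : SL(2, ℝ)} {x : ℝ}
    (hx : 0 < x ^ 2 + x * (A : Matrix (Fin 2) (Fin 2) ℝ).trace + 1) :
    ∃ G : SL(2, ℝ), ∃ r : ℝ, r ≠ 0 ∧
      r • (G : Matrix (Fin 2) (Fin 2) ℝ) = x • 1 + (A : Matrix (Fin 2) (Fin 2) ℝ) := by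
  set D := x ^ 2 + x * (A : Matrix (Fin 2) (Fin 2) ℝ).trace + 1
  have hD : (x • 1 + (A : Matrix (Fin 2) (Fin 2) ℝ)).det = D := by
    have := A.det_coe
    rw [Matrix.det_fin_two] at this
    simp [Matrix.det_fin_two, Matrix.trace_fin_two, D]
    linear_combination this
  have hr : √D ≠ 0 := (Real.sqrt_pos.2 hx).ne'
  refine ⟨⟨(√D)⁻¹ • (x • 1 + (A : Matrix (Fin 2) (Fin 2) ℝ)), ?_⟩, √D, hr, smul_inv_smul₀ hr _⟩
  rw [Matrix.det_smul, hD, Fintype.card_fin, inv_pow, Real.sq_sqrt hx.le, inv_mul_cancel₀ hx.ne']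

/-- The reduced norm `(n + v) * (n + star v)` is the scalar `n ^ 2 + n * (v + star v) + 1`, so no
division algebra is needed. -/
theorem exists_inverse_natCast_add {k : Type} [Field k] {a b : k} {v : QuaternionAlgebra k a 0 b}
    (hv : v * star v = 1) {n : ℕ} (hn : (n : k) ^ 2 + n * (2 * v.re) + 1 ≠ 0) :
    ∃ y : QuaternionAlgebra k a 0 b, (n + v) * y = 1 ∧ y * (n + v) = 1 := by
  set s := (n : k) ^ 2 + n * (2 * v.re) + 1
  have hv' : star v * v = 1 := by rw [star_comm_self', hv]
  have ht : v + star v = algebraMap k _ (2 * v.re) := by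
    have := QuaternionAlgebra.self_add_star' v
    rwa [zero_mul, add_zero] at this
  have hs : (n : QuaternionAlgebra k a 0 b) ^ 2 + n * (v + star v) + 1 = algebraMap k _ s := by
    rw [ht, ← map_natCast (algebraMap k (QuaternionAlgebra k a 0 b))]; simp only [s, map_add, map_mul, map_pow, map_one]
  have hc : (n : QuaternionAlgebra k a 0 b) * star v = star v * n := Nat.cast_commute n _
  have hc' : (n : QuaternionAlgebra k a 0 b) * v = v * n := Nat.cast_commute n _
  have h1 : (n + v) * (n + star v) = algebraMap k _ s := by
    rw [← hs, ← hv, add_mul, mul_add, mul_add, ← hc', mul_add, sq]; abel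
  have h2 : (n + star v) * (n + v) = algebraMap k _ s := by
    rw [← hs, ← hv', add_mul, mul_add, mul_add, ← hc, mul_add, sq]; abel
  have h3 : algebraMap k (QuaternionAlgebra k a 0 b) s * algebraMap k _ s⁻¹ = 1 := by
    rw [← map_mul, mul_inv_cancel₀ hn, map_one]
  refine ⟨(n + star v) * algebraMap k _ s⁻¹, by rw [← mul_assoc, h1, h3], ?_⟩
  rw [← Algebra.commutes, mul_assoc, h2, Algebra.commutes, h3]

/-! ### Infinite multiplicity -/

theorem infinite_intersections {Γ : Subgroup PSL(2, ℝ)} (hΓ : IsArithmeticFuchsian Γ)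
    {θ : ℝ} (hθ : θ ∈ angleSpectrum Γ) : (intersections Γ θ).Infinite := by
  obtain ⟨hF, k, _, _, _, σ, a, b, -, -, ρ, O, -, -, hO, hcomm⟩ := hΓ
  obtain ⟨_, α, hα, β, hβ, hαh, hβh, z, hz, rfl⟩ := hθ
  obtain ⟨m, hm, -, hαm⟩ := Subgroup.exists_pow_mem_of_relIndex_ne_zero hcomm.2 hα
  obtain ⟨u, hu, A, hA, hAα⟩ := mem_projectiveNormOneUnits_iff.1 hαm.1
  have hAh : (A : Matrix (Fin 2) (Fin 2) ℝ).IsHyperbolic :=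
    IsHyperbolic.of_mk (by rw [hAα]; exact (hαh.pow hm).1)
  have key : ∀ᶠ n : ℕ in atTop, ∃ G : SL(2, ℝ), ∃ r : ℝ, r ≠ 0 ∧
      r • (G : Matrix (Fin 2) (Fin 2) ℝ) = (n : ℝ) • 1 + (A : Matrix (Fin 2) (Fin 2) ℝ) ∧
      ∀ x ∈ Γ, ∃ m : ℕ, 0 < m ∧ (G : PSL(2, ℝ)) * x ^ m * (G : PSL(2, ℝ))⁻¹ ∈ Γ := by
    -- The first condition says `det (n + A) > 0`; the second says that `σ` of the reduced norm of
    -- `n + u` is positive, so `n + u` is invertible.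
    filter_upwards [eventually_sq_add_mul_add_one_pos (A : Matrix (Fin 2) (Fin 2) ℝ).trace,
      eventually_sq_add_mul_add_one_pos (σ (2 * ((u : O) : QuaternionAlgebra k a 0 b).re))]
      with n hn hn'
    obtain ⟨G, r, hr, h⟩ := exists_sl_smul_eq hn
    obtain ⟨y, hy, hy'⟩ := exists_inverse_natCast_add (n := n) hu fun h0 => by
      simpa using hn'.ne' (by simpa using congrArg σ h0)
    refine ⟨G, r, hr, h, fun x hx => exists_conj_pow_mem_of_commensurable hO hcomm hy hy' (r := r) ?_ hx⟩
    rw [h, map_add, ← hA, map_natCast, ← nsmul_one, Nat.cast_smul_eq_nsmul]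
  obtain ⟨N, hN⟩ := eventually_atTop.1 key
  choose G r hr hG hconj using fun n => hN (n + N) (Nat.le_add_left _ _)
  have hlim := tendsto_sl_smul hr hG
    (tendsto_natCast_atTop_atTop.comp (tendsto_add_atTop_nat N)) z
  have hinf := hF.infinite_range_proj hlim fun n => sl_smul_ne_of_smul_eq (hr n) (hG n) hAh z
  -- The intersection points alone already distinguish infinitely many triples.
  refine Set.Infinite.of_image (fun p => p.2.2) (hinf.mono ?_)
  rintro _ ⟨n, rfl⟩
  obtain ⟨p, hp, h⟩ := exists_mem_intersections (hconj n) hα hβ hαh hβh hz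
  exact ⟨p, hp, by rw [mk_smul] at h; exact h⟩

end FuchsianAngles

theorem mainTheorem8 (Γ : Subgroup (Matrix.ProjectiveSpecialLinearGroup (Fin 2) ℝ))
    (hΓ : FuchsianAngles.IsArithmeticFuchsian Γ)
    (θ : ℝ) (hθ : θ ∈ FuchsianAngles.angleSpectrum Γ) :
    FuchsianAngles.angleMultiplicity Γ θ = ⊤ :=
  Set.encard_eq_top (FuchsianAngles.infinite_intersections hΓ hθ)
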